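/- Let $K$ be an algebraically closed field of characteristic $0$, let $\mathfrak g$ be a finite-dimensional simple Lie algebra over $K$ that is not isomorphic to $\mathfrak{sl}(2)$, and let $V$ be a finite-dimensional irreducible $\mathfrak g$-module, with action denoted by $\bullet$. Let $\delta \in K$ with $\delta \neq 1$, and let $D : \mathfrak g \to V$ be a nonzero $\delta$-derivation, that is, a nonzero $K$-linear map such that $$D([x,y]) = -\delta\, y \bullet D(x) + \delta\, x \bullet D(y) \quad \text{for all } x, y \in \mathfrak g.$$ Then $\delta = \frac12$, $V$ is isomorphic, as a $\mathfrak g$-module, to the adjoint module $\mathfrak g$, and $D$ is a scalar multiple of the identity map after identifying $V$ with $\mathfrak g$: for every isomorphism of $\mathfrak g$-modules $e : \mathfrak g \to V$ there is $c \in K$ such that $D(x) = c\, e(x)$ for all $x \in \mathfrak g$. -/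

import Mathlib

/-- The space `Der_δ(L, V)` of `δ`-derivations of a Lie algebra `L` with values in an `L`-module
`V`: the linear maps `D : L → V` such that
`D [x, y] = - δ y • D x + δ x • D y` for all `x, y`, where `•` is the action of `L` on `V`. -/
def deltaDerivations (R L V : Type*) [CommRing R] [LieRing L] [LieAlgebra R L]
    [AddCommGroup V] [Module R V] [LieRingModule L V] [LieModule R L V] (δ : R) :
    Submodule R (L →ₗ[R] V) where
  carrier := {D | ∀ x y : L, D ⁅x, y⁆ = -(δ • ⁅y, D x⁆) + δ • ⁅x, D y⁆}
  zero_mem' := by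
    intro x y
    simp
  add_mem' := by
    intro D E hD hE x y
    simp only [LinearMap.add_apply, lie_add, smul_add]
    rw [hD x y, hE x y]
    abel
  smul_mem' := by
    intro c D hD x y
    simp only [LinearMap.smul_apply, lie_smul]
    rw [hD x y, smul_add, smul_neg, smul_comm c δ, smul_comm c δ]

/-! The `δ`-derivations form a `𝔤`-submodule `M` of `Hom(𝔤, V)`, and the point is that `𝔤` acts
trivially on `M` when `δ ≠ 0, 1`. A weight vector of nonzero weight in `M` would give a root
orthogonal to all roots but itself and its opposite (`exists_orthogonal_of_mem_deltaDerivations`).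
Its `sl₂` would then be an ideal, so all of `𝔤`, which is excluded
(`nonempty_equiv_sl_of_orthogonal`). With only the weight zero, root vectors kill `M`, hence so does
`𝔤` by simplicity. So `D` is a module map: Schur's lemma gives the isomorphism and the scalar, and
the defining identity becomes `D ⁅x, y⁆ = 2δ D ⁅x, y⁆`. -/

open LieAlgebra LieAlgebra.IsKilling LieModule

/-! ### Root systems: an isolated root forces `sl₂`. -/

section Rank
variable {K 𝔤 : Type*} [Field K] [LieRing 𝔤] [LieAlgebra K 𝔤]

/-- The Lie algebra homomorphism from `sl₂` determined by an `sl₂` triple. -/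
def IsSl2Triple.slHom {h e f : 𝔤} (t : IsSl2Triple h e f) :
    SpecialLinear.sl (Fin 2) K →ₗ⁅K⁆ 𝔤 where
  toFun A := A.val 0 0 • h + A.val 0 1 • e + A.val 1 0 • f
  map_add' A B := by
    change (A.val 0 0 + B.val 0 0) • h + (A.val 0 1 + B.val 0 1) • e +
      (A.val 1 0 + B.val 1 0) • f = _
    module
  map_smul' c A := by
    change (c * A.val 0 0) • h + (c * A.val 0 1) • e + (c * A.val 1 0) • f = c • _
    module
  map_lie' := by
    intro A B
    have tr (A : SpecialLinear.sl (Fin 2) K) : A.val 1 1 = - A.val 0 0 := by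
      have : Matrix.trace A.val = 0 := A.2
      rw [Matrix.trace_fin_two] at this
      linear_combination this
    have he := t.lie_h_e_smul K
    have hf := t.lie_lie_smul_f K
    have hef := t.lie_e_f
    have he' : ⁅e, h⁆ = -((2 : K) • e) := by rw [← lie_skew, he]
    have hf' : ⁅f, h⁆ = (2 : K) • f := by rw [← lie_skew, hf, neg_neg]
    have hef' : ⁅f, e⁆ = -h := by rw [← lie_skew, hef]
    simp only [SpecialLinear.sl_bracket, Matrix.sub_apply, Matrix.mul_apply, Fin.sum_univ_two,
      tr, lie_add, add_lie, lie_smul, smul_lie, lie_self, he, hf, hef, he', hf', hef']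
    module

lemma IsSl2Triple.slHom_apply {h e f : 𝔤} (t : IsSl2Triple h e f)
    (A : SpecialLinear.sl (Fin 2) K) :
    t.slHom A = A.val 0 0 • h + A.val 0 1 • e + A.val 1 0 • f := rfl

variable [CharZero K]

lemma IsSl2Triple.slHom_injective {h e f : 𝔤} (t : IsSl2Triple h e f) :
    Function.Injective (t.slHom (K := K)) := by
  rw [injective_iff_map_eq_zero]
  intro A hA
  rw [slHom_apply] at hA
  have he := t.lie_h_e_smul K
  have hf := t.lie_lie_smul_f K
  have h1 := congr(⁅h, $hA⁆)
  simp only [lie_add, lie_smul, lie_self, he, hf, lie_zero] at h1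
  have h2 := congr(⁅h, $h1⁆)
  simp only [lie_add, lie_smul, lie_neg, he, hf, lie_zero] at h2
  -- `ad h` has eigenvalues `2` on `e` and `-2` on `f`, so `h1` and `h2` separate the two
  -- components.
  have e0 : A.val 0 1 • e = 0 := by
    linear_combination (norm := module) (1 / 4 : K) • h1 + (1 / 8 : K) • h2
  have f0 : A.val 1 0 • f = 0 := by
    linear_combination (norm := module) -(1 / 4 : K) • h1 + (1 / 8 : K) • h2
  have h0 : A.val 0 0 • h = 0 := by simpa [e0, f0] using hA
  have e0 := (smul_eq_zero.mp e0).resolve_right t.e_ne_zero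
  have f0 := (smul_eq_zero.mp f0).resolve_right t.f_ne_zero
  have h0 := (smul_eq_zero.mp h0).resolve_right t.h_ne_zero
  have tr : A.val 1 1 = - A.val 0 0 := by
    have : Matrix.trace A.val = 0 := A.2
    rw [Matrix.trace_fin_two] at this
    linear_combination this
  ext i j
  fin_cases i <;> fin_cases j <;> simp [e0, f0, h0, tr]

variable [FiniteDimensional K 𝔤] [IsSimple K 𝔤] {H : LieSubalgebra K 𝔤} [H.IsCartanSubalgebra]
  [IsTriangularizable K H 𝔤]

lemma LieAlgebra.IsKilling.apply_coroot_eq_zero_comm {α β : Weight K H 𝔤}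
    (hα : α.IsNonZero) (hβ : β.IsNonZero) (h : α (coroot β) = 0) : β (coroot α) = 0 := by
  have := (rootSystem H).pairing_eq_zero_iff' (i := ⟨α, by simpa using hα⟩)
    (j := ⟨β, by simpa using hβ⟩)
  simp only [rootSystem_pairing_apply] at this
  exact this.mp h

/-- In a simple Lie algebra other than `sl₂` no root is orthogonal to all roots other than itself
and its opposite. -/
lemma LieAlgebra.IsKilling.nonempty_equiv_sl_of_orthogonal {α : Weight K H 𝔤} (hα : α.IsNonZero)
    (horth : ∀ β : Weight K H 𝔤, β.IsNonZero → β ≠ α → β ≠ -α → α (coroot β) = 0) :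
    Nonempty (𝔤 ≃ₗ⁅K⁆ SpecialLinear.sl (Fin 2) K) := by
  obtain ⟨h, e, f, t, he, hf⟩ := exists_isSl2Triple_of_weight_isNonZero hα
  -- If `β ± α` were a weight, its value `±2` at `coroot α` would make it a root not orthogonal to
  -- `α`, hence `α` or `-α`. This contradicts `β ≠ 0` or `β (coroot α) = 0`.
  have key (β : Weight K H 𝔤) (hβ : β.IsNonZero) (h1 : β ≠ α) (h2 : β ≠ -α)
      (ε : Weight K H 𝔤) (hε : ε = α ∨ ε = -α) (x y : 𝔤) (hx : x ∈ rootSpace H β)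
      (hy : y ∈ rootSpace H ε) : ⁅x, y⁆ = 0 := by
    have hxy := lie_mem_genWeightSpace_of_mem_genWeightSpace hx hy
    by_contra hne
    have hbot : rootSpace H (β + ε : H → K) ≠ ⊥ := fun hb ↦ hne (by simpa [hb] using hxy)
    let γ : Weight K H 𝔤 := ⟨β + ε, hbot⟩
    have hβα := apply_coroot_eq_zero_comm hα hβ (horth β hβ h1 h2)
    have hα2 : α (coroot α) = 2 := root_apply_coroot hα
    have hγ : γ (coroot α) ≠ 0 := by
      rcases hε with rfl | rfl <;> simp [γ, hβα, hα2]
    have hγ0 : γ.IsNonZero := fun h0 ↦ hγ (by rw [h0.eq]; rfl)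
    refine hγ (apply_coroot_eq_zero_comm hα hγ0 (horth γ hγ0 ?_ ?_))
    · intro hγα
      have := congr($hγα (coroot α))
      rcases hε with rfl | rfl <;> simp [γ, hβα, hα2] at this
      · exact hβ (by ext z; simpa [γ] using congr($hγα z))
      · norm_num [neg_eq_iff_add_eq_zero] at this
    · intro hγα
      have := congr($hγα (coroot α))
      rcases hε with rfl | rfl <;> simp [γ, hβα, hα2] at this
      · norm_num [eq_neg_iff_add_eq_zero] at this
      · exact hβ (by ext z; simpa [γ] using congr($hγα z))
  let I : LieIdeal K 𝔤 :=
    { (t.toLieSubalgebra K).toSubmodule with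
      lie_mem := by
        intro x m hm
        have hs (c : K) {z : 𝔤} (hz : z ∈ t.toLieSubalgebra K) : c • z ∈ t.toLieSubalgebra K :=
          (t.toLieSubalgebra K).smul_mem c hz
        have he' : e ∈ t.toLieSubalgebra K := Submodule.subset_span (by simp)
        have hf' : f ∈ t.toLieSubalgebra K := Submodule.subset_span (by simp)
        have hh' : h ∈ t.toLieSubalgebra K := Submodule.subset_span (by simp)
        change m ∈ t.toLieSubalgebra K at hm
        change ⁅x, m⁆ ∈ t.toLieSubalgebra K
        have hx : x ∈ ⨆ χ : Weight K H 𝔤, genWeightSpace 𝔤 χ := by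
          simp [iSup_genWeightSpace_eq_top' K H 𝔤]
        induction hx using LieSubmodule.iSup_induction' with
        | zero => simp
        | add y z _ _ hy hz => rw [add_lie]; exact add_mem hy hz
        | mem β x hx =>
          obtain ⟨a, b, c, rfl⟩ := IsSl2Triple.mem_toLieSubalgebra_iff.mp hm
          by_cases hβ : β.IsZero
          · have hxH : x ∈ H := by
              rw [show (β : H → K) = 0 from hβ] at hx
              simpa using (rootSpace_zero_eq K 𝔤 H).le hx
            have e1 : ⁅x, e⁆ = α ⟨x, hxH⟩ • e := lie_eq_smul_of_mem_rootSpace he ⟨x, hxH⟩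
            have f1 : ⁅x, f⁆ = (-α) ⟨x, hxH⟩ • f := lie_eq_smul_of_mem_rootSpace hf ⟨x, hxH⟩
            rw [lie_add, lie_add, lie_smul, lie_smul, lie_smul, leibniz_lie, e1, f1, smul_lie,
              lie_smul, t.lie_e_f]
            exact add_mem (add_mem (hs _ (hs _ he')) (hs _ (hs _ hf')))
              (hs _ (add_mem (hs _ hh') (hs _ hh')))
          by_cases h1 : β = α
          · subst h1
            obtain ⟨c, hc⟩ := (finrank_eq_one_iff_of_nonzero' ⟨e, he⟩
              (by simpa using t.e_ne_zero)).mp (finrank_rootSpace_eq_one β hβ) ⟨x, hx⟩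
            have : x = c • e := by simpa using congr(($hc).val).symm
            rw [this]
            exact (t.toLieSubalgebra K).lie_mem (hs _ he') hm
          by_cases h2 : β = -α
          · subst h2
            obtain ⟨c, hc⟩ := (finrank_eq_one_iff_of_nonzero'
              (V := rootSpace H (-α : Weight K H 𝔤)) ⟨f, hf⟩ (by simpa using t.f_ne_zero)).mp
              (finrank_rootSpace_eq_one (-α) hβ) ⟨x, hx⟩
            have : x = c • f := by simpa using congr(($hc).val).symm
            rw [this]
            exact (t.toLieSubalgebra K).lie_mem (hs _ hf') hm
          · have e1 : ⁅x, e⁆ = 0 := key β hβ h1 h2 α (.inl rfl) x e hx he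
            have f1 : ⁅x, f⁆ = 0 := key β hβ h1 h2 (-α) (.inr rfl) x f hx hf
            rw [lie_add, lie_add, lie_smul, lie_smul, lie_smul, leibniz_lie, e1, f1]
            simp }
  have hI : I = ⊤ := by
    refine (IsSimple.eq_bot_or_eq_top (R := K) I).resolve_left fun hb ↦ t.e_ne_zero ?_
    have : e ∈ I := Submodule.subset_span (by simp)
    simpa [hb] using this
  refine ⟨(LieEquiv.ofBijective (t.slHom (K := K)) ⟨t.slHom_injective, fun x ↦ ?_⟩).symm⟩
  have hx : x ∈ I := hI ▸ LieSubmodule.mem_top x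
  obtain ⟨a, b, c, rfl⟩ := (IsSl2Triple.mem_toLieSubalgebra_iff (R := K) (t := t)).mp hx
  refine ⟨⟨!![c, a; b, -c], ?_⟩, ?_⟩
  · refine LinearMap.mem_ker.2 ?_
    simp [Matrix.trace_fin_two]
  · simp only [IsSl2Triple.slHom_apply, t.lie_e_f]
    simp
    module

end Rank

/-! ### Invariance of `δ`-derivations. -/

section DeltaDerivations
variable {K 𝔤 V : Type*} [Field K] [LieRing 𝔤] [LieAlgebra K 𝔤]
  [AddCommGroup V] [Module K V] [LieRingModule 𝔤 V] [LieModule K 𝔤 V]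

variable (K 𝔤 V) in
/-- The `δ`-derivations form a Lie submodule of the linear maps. -/
def deltaDerivationsLie (δ : K) : LieSubmodule K 𝔤 (𝔤 →ₗ[K] V) :=
  { deltaDerivations K 𝔤 V δ with
    lie_mem := by
      intro z D hD x y
      have hD : ∀ x y : 𝔤, D ⁅x, y⁆ = -(δ • ⁅y, D x⁆) + δ • ⁅x, D y⁆ := hD
      simp only [LieHom.lie_apply, leibniz_lie z x y, map_add, hD, lie_add, lie_neg,
        lie_sub, lie_smul, leibniz_lie z x (D y), leibniz_lie z y (D x)]
      module }

lemma lie_apply_of_mem_deltaDerivations {δ : K} {D : 𝔤 →ₗ[K] V}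
    (hD : D ∈ deltaDerivations K 𝔤 V δ) (z x : 𝔤) :
    ⁅z, D⁆ x = (1 - δ) • ⁅z, D x⁆ + δ • ⁅x, D z⁆ := by
  have hD : ∀ x y : 𝔤, D ⁅x, y⁆ = -(δ • ⁅y, D x⁆) + δ • ⁅x, D y⁆ := hD
  rw [LieHom.lie_apply, hD]
  module

variable [IsSimple K 𝔤]

/-- For `δ = 0` the map kills all brackets, so its kernel is an ideal, nonzero because `𝔤` is not
abelian. -/
lemma eq_zero_of_mem_deltaDerivations_zero {D : 𝔤 →ₗ[K] V}
    (hD : D ∈ deltaDerivations K 𝔤 V 0) : D = 0 := by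
  have hD : ∀ x y : 𝔤, D ⁅x, y⁆ = -((0 : K) • ⁅y, D x⁆) + (0 : K) • ⁅x, D y⁆ := hD
  simp only [zero_smul, neg_zero, add_zero] at hD
  let I : LieIdeal K 𝔤 := { LinearMap.ker D with lie_mem := fun _ ↦ hD _ _ }
  rcases IsSimple.eq_bot_or_eq_top (R := K) I with hI | hI
  · refine absurd ⟨fun x y ↦ ?_⟩ (IsSimple.non_abelian K (L := 𝔤))
    have : ⁅x, y⁆ ∈ I := hD x y
    simpa [hI] using this
  · ext x
    exact (hI ▸ LieSubmodule.mem_top x : x ∈ I)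

variable [CharZero K] [FiniteDimensional K 𝔤] {H : LieSubalgebra K 𝔤}
  [H.IsCartanSubalgebra] [IsTriangularizable K H 𝔤]

/-- A weight vector of nonzero weight among the `δ`-derivations yields a root orthogonal to all
roots other than itself and its opposite. -/
lemma exists_orthogonal_of_mem_deltaDerivations {δ : K} (hδ : δ ≠ 1) (hδ0 : δ ≠ 0)
    {D : 𝔤 →ₗ[K] V} (hD : D ∈ deltaDerivations K 𝔤 V δ) (hD0 : D ≠ 0) {χ : Module.Dual K H}
    (hχ : χ ≠ 0) (hDχ : ∀ h : H, ⁅(h : 𝔤), D⁆ = χ h • D) :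
    ∃ α : Weight K H 𝔤, α.IsNonZero ∧
      ∀ β : Weight K H 𝔤, β.IsNonZero → β ≠ α → β ≠ -α → α (coroot β) = 0 := by
  have hD' : ∀ x y : 𝔤, D ⁅x, y⁆ = -(δ • ⁅y, D x⁆) + δ • ⁅x, D y⁆ := hD
  have hwt (α : H → K) (e : 𝔤) (he : e ∈ rootSpace H α) (h : H) :
      ⁅(h : 𝔤), D e⁆ = (χ h + α h) • D e := by
    have h1 := congr($(hDχ h) e)
    have h2 : ⁅(h : 𝔤), e⁆ = α h • e := lie_eq_smul_of_mem_rootSpace he h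
    rw [LieHom.lie_apply, h2, map_smul, LinearMap.smul_apply, sub_eq_iff_eq_add] at h1
    rw [h1, add_smul]
  have hwt0 (h h' : H) : ⁅(h : 𝔤), D h'⁆ = χ h • D h' := by
    have h1 := congr($(hDχ h) h')
    have h2 : ⁅(h : 𝔤), (h' : 𝔤)⁆ = 0 := congr(($(trivial_lie_zero H H h h')).val)
    rwa [LieHom.lie_apply, h2, map_zero, sub_zero] at h1
  obtain ⟨h₀, hh₀⟩ : ∃ h, χ h = 1 := LinearMap.surjective hχ 1
  set v := D h₀ with hv
  have hDH (h : H) : D h = χ h • v := by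
    have h1 := lie_apply_of_mem_deltaDerivations hD h₀ h
    rw [hDχ, LinearMap.smul_apply, hh₀, hwt0, ← hv, hwt0, hh₀] at h1
    refine smul_right_injective V hδ0 ?_
    change δ • D h = δ • χ h • v
    linear_combination (norm := module) h1
  -- The action of `h` on `D`, evaluated at a root vector; both cases below rest on this relation.
  have hroot (α : H → K) (e : 𝔤) (he : e ∈ rootSpace H α) (h : H) :
      (δ * χ h) • ⁅e, v⁆ = (δ * χ h - (1 - δ) * α h) • D e := by
    have h1 := lie_apply_of_mem_deltaDerivations hD h e
    rw [hDχ, LinearMap.smul_apply, hwt α e he, hDH, lie_smul] at h1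
    linear_combination (norm := module) -h1
  have hcoroot (β : Weight K H 𝔤) (hβ : β.IsNonZero) (w : V)
      (h1 : ∀ e ∈ rootSpace H β, ⁅e, w⁆ = 0) (h2 : ∀ e ∈ rootSpace H (-β), ⁅e, w⁆ = 0) :
      ⁅(coroot β : 𝔤), w⁆ = 0 := by
    obtain ⟨h, e, f, t, he, hf⟩ := exists_isSl2Triple_of_weight_isNonZero hβ
    rw [← t.h_eq_coroot hβ he hf, ← t.lie_e_f, lie_lie, h1 e he, h2 f hf]
    simp
  -- If `v = 0`, then `D` lives on the single root space with `δχ = (1 - δ)α`, and `D e` has weight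
  -- `χ + α = δ⁻¹α`. Otherwise `v` has weight `χ`, and root vectors for roots not proportional to
  -- `χ` kill it.
  by_cases hv0 : v = 0
  · have hDH0 (h : H) : D h = 0 := by rw [hDH, hv0, smul_zero]
    have hroot0 (α : H → K) (e : 𝔤) (he : e ∈ rootSpace H α) (hne : D e ≠ 0) (h : H) :
        δ * χ h = (1 - δ) * α h := by
      have := hroot α e he h
      rw [hv0, lie_zero, smul_zero, eq_comm, smul_eq_zero] at this
      exact sub_eq_zero.mp (this.resolve_right hne)
    obtain ⟨α, e, he, hne⟩ : ∃ α : Weight K H 𝔤, ∃ e ∈ rootSpace H α, D e ≠ 0 := by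
      by_contra! hcon
      refine hD0 (LinearMap.ext fun x ↦ ?_)
      have hx : x ∈ ⨆ χ : Weight K H 𝔤, genWeightSpace 𝔤 χ := by
        simp [iSup_genWeightSpace_eq_top' K H 𝔤]
      induction hx using LieSubmodule.iSup_induction' with
      | zero => simp
      | add y z _ _ hy hz => simp [hy, hz]
      | mem β x hx => exact hcon β x hx
    have hα : α.IsNonZero := by
      intro h0
      rw [show (α : H → K) = 0 from h0] at he
      have heH : e ∈ H := by simpa using (rootSpace_zero_eq K 𝔤 H).le he
      exact hne (hDH0 ⟨e, heH⟩)
    have hsupp (β : H → K) (f : 𝔤) (hf : f ∈ rootSpace H β) (hβ : β ≠ α) : D f = 0 := by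
      by_contra hf0
      refine hβ (funext fun h ↦ mul_left_cancel₀ (sub_ne_zero.mpr hδ.symm) ?_)
      rw [← hroot0 β f hf hf0, ← hroot0 α e he hne]
    have hkill (β : H → K) (hβ : β ≠ α) (hβ0 : β ≠ 0) (f : 𝔤) (hf : f ∈ rootSpace H β) :
        ⁅f, D e⁆ = 0 := by
      have h1 := hD' f e
      rw [hsupp β f hf hβ, hsupp (β + α) _ (lie_mem_genWeightSpace_of_mem_genWeightSpace hf he)
        (by simpa using hβ0)] at h1
      simpa [hδ0] using h1.symm
    refine ⟨α, hα, fun β hβ h1 h2 ↦ ?_⟩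
    have h3 := hcoroot β hβ (D e)
      (hkill β (fun h ↦ h1 (DFunLike.coe_injective h)) hβ)
      (hkill (-β) (fun h ↦ h2 (by ext z; simp [← h])) (by simpa using hβ))
    rw [hwt α e he, smul_eq_zero] at h3
    have h4 := hroot0 α e he hne (coroot β)
    linear_combination -h4 + δ * h3.resolve_right hne
  · have hprop (α : H → K) (e : 𝔤) (he : e ∈ rootSpace H α) (hα : ∀ c : K, α ≠ c • χ) :
        ⁅e, v⁆ = 0 := by
      have h1 := hroot α e he
      -- Comparing `hroot` at `h` and at `h₀` eliminates `⁅e, v⁆` and leaves a nonzero multiple of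
      -- `D e`.
      obtain ⟨h, hh⟩ : ∃ h, α h ≠ α h₀ * χ h := by
        by_contra! hcon
        exact hα (α h₀) (funext hcon)
      have e1 := h1 h
      have e2 := h1 h₀
      rw [hh₀] at e2
      have hDe : D e = 0 := by
        have : ((1 - δ) * (α h - α h₀ * χ h)) • D e = 0 := by
          linear_combination (norm := module) e1 - χ h • e2
        refine (smul_eq_zero.mp this).resolve_left (mul_ne_zero (sub_ne_zero.mpr hδ.symm) ?_)
        exact sub_ne_zero.mpr hh
      simpa [hDe, hδ0] using e2
    have hprop' (β : Weight K H 𝔤) (hβ : β.IsNonZero) (hc : ∀ c : K, (β : H → K) ≠ c • χ) :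
        χ (coroot β) = 0 := by
      have h1 := hcoroot β hβ v (fun e he ↦ hprop β e he hc) (fun e he ↦ hprop (-β) e he
        fun c hc' ↦ hc (-c) (by rw [neg_smul, ← hc', neg_neg]))
      rw [hv, hwt0, smul_eq_zero] at h1
      exact h1.resolve_right hv0
    -- Otherwise `χ` would vanish on all coroots, which span `H`.
    obtain ⟨α, hα, c, hαc⟩ : ∃ α : Weight K H 𝔤, α.IsNonZero ∧ ∃ c : K, (α : H → K) = c • χ := by
      by_contra! hcon
      refine hχ (LinearMap.ext_on_range (v := (rootSystem H).coroot)
        (RootPairing.IsRootSystem.span_coroot_eq_top) fun β ↦ ?_)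
      have hβ : β.1.IsNonZero := (Finset.mem_filter.mp β.2).2
      exact hprop' β hβ (hcon β hβ)
    refine ⟨α, hα, fun β hβ h1 h2 ↦ ?_⟩
    have hc0 : c ≠ 0 := by
      rintro rfl
      exact hα (by simpa using hαc)
    rw [hαc, Pi.smul_apply, hprop' β hβ, smul_zero]
    intro d hd
    rcases eq_neg_or_eq_of_eq_smul α β hβ (d * c⁻¹)
      (by rw [hd, hαc, smul_smul, inv_mul_cancel_right₀ hc0]) with h | h
    exacts [h2 h, h1 h]

/-- The `δ`-derivations of a simple Lie algebra other than `sl₂` are invariant, unless `δ = 1`. -/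
lemma lie_eq_zero_of_mem_deltaDerivations [IsAlgClosed K] [FiniteDimensional K V]
    (hsl2 : IsEmpty (𝔤 ≃ₗ⁅K⁆ SpecialLinear.sl (Fin 2) K)) {δ : K} (hδ : δ ≠ 1) (hδ0 : δ ≠ 0)
    {D : 𝔤 →ₗ[K] V} (hD : D ∈ deltaDerivations K 𝔤 V δ) (x : 𝔤) : ⁅x, D⁆ = 0 := by
  obtain ⟨a, ha⟩ := LieAlgebra.exists_isCartanSubalgebra_engel K 𝔤
  set H := LieSubalgebra.engel K a
  let M := deltaDerivationsLie K 𝔤 V δ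
  have hM0 (χ : Weight K H M) : (χ : H → K) = 0 := by
    by_contra hχ
    obtain ⟨D, hD0, hDχ⟩ := exists_forall_lie_eq_smul K H M χ
    obtain ⟨α, hα, horth⟩ := exists_orthogonal_of_mem_deltaDerivations (H := H) hδ hδ0 D.2
      (by simpa using hD0) (χ := χ.toLinear) (by simpa using hχ)
      (fun h ↦ congr(($(hDχ h)).val))
    exact not_nonempty_iff.mpr hsl2 (nonempty_equiv_sl_of_orthogonal hα horth)
  have htop : genWeightSpace M (0 : H → K) = ⊤ := by
    rw [eq_top_iff, ← iSup_genWeightSpace_eq_top' K H M]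
    exact iSup_le fun χ ↦ (hM0 χ ▸ le_rfl)
  have hroot (α : Weight K H 𝔤) (hα : α.IsNonZero) (e : 𝔤) (he : e ∈ rootSpace H α) :
      e ∈ LieModule.ker K 𝔤 M := by
    rw [LieModule.mem_ker]
    intro m
    have hm : m ∈ genWeightSpace M (0 : H → K) := htop ▸ LieSubmodule.mem_top m
    -- A root vector sends weight `0` to weight `α ≠ 0`, which does not occur in `M`.
    have := lie_mem_genWeightSpace_of_mem_genWeightSpace he hm
    rw [add_zero] at this
    by_contra hne
    exact hα (hM0 ⟨α, fun hb ↦ hne (by simpa [hb] using this)⟩)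
  have hker : LieModule.ker K 𝔤 M = ⊤ := by
    refine (IsSimple.eq_bot_or_eq_top _).resolve_left fun hb ↦ ?_
    have hH : H.toLieSubmodule = ⊤ := by
      rw [← cartan_sup_iSup_rootSpace_eq_top H, eq_comm, sup_eq_left]
      refine iSup₂_le fun α hα e he ↦ ?_
      have := hroot α hα e he
      rw [hb, LieSubmodule.mem_bot] at this
      simp [this]
    refine IsSimple.non_abelian K (L := 𝔤) ⟨fun x y ↦ ?_⟩
    have hmem (z : 𝔤) : z ∈ H := by
      simpa using (hH ▸ LieSubmodule.mem_top z : z ∈ H.toLieSubmodule)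
    exact congr(($(trivial_lie_zero H H ⟨x, hmem x⟩ ⟨y, hmem y⟩)).val)
  have := (LieModule.mem_ker K 𝔤 M x).mp (hker ▸ LieSubmodule.mem_top x) ⟨D, hD⟩
  exact congr(($this).val)

end DeltaDerivations

/-! ### Schur's lemma and the conclusion. -/

/-- A scalar version of Schur's lemma for endomorphisms of the adjoint module. -/
lemma LieAlgebra.IsSimple.exists_eq_smul_of_comm {K 𝔤 : Type*} [Field K] [IsAlgClosed K]
    [LieRing 𝔤] [LieAlgebra K 𝔤] [FiniteDimensional K 𝔤] [IsSimple K 𝔤] (f : 𝔤 →ₗ⁅K,𝔤⁆ 𝔤) :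
    ∃ c : K, ∀ x, f x = c • x := by
  have : Nontrivial 𝔤 := (LieSubmodule.nontrivial_iff K 𝔤 𝔤).mp inferInstance
  obtain ⟨c, hc⟩ := Module.End.exists_eigenvalue (f : Module.End K 𝔤)
  obtain ⟨x, hx, hx0⟩ := hc.exists_hasEigenvector
  have hx : f x = c • x := Module.End.mem_eigenspace_iff.mp hx
  refine ⟨c, fun y ↦ ?_⟩
  have hker : (f - c • LieModuleHom.id).ker = ⊤ := by
    refine (IsSimple.eq_bot_or_eq_top (R := K) _).resolve_left fun hb ↦ hx0 ?_
    have : x ∈ (f - c • (LieModuleHom.id : 𝔤 →ₗ⁅K,𝔤⁆ 𝔤)).ker := by simp [LieModuleHom.mem_ker, hx]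
    simpa [hb] using this
  have : y ∈ (f - c • (LieModuleHom.id : 𝔤 →ₗ⁅K,𝔤⁆ 𝔤)).ker := hker ▸ LieSubmodule.mem_top y
  simpa [LieModuleHom.mem_ker, sub_eq_zero] using this

theorem mainTheorem3 {K 𝔤 V : Type*} [Field K] [IsAlgClosed K] [CharZero K]
    [LieRing 𝔤] [LieAlgebra K 𝔤] [FiniteDimensional K 𝔤] [LieAlgebra.IsSimple K 𝔤]
    (hsl2 : IsEmpty (𝔤 ≃ₗ⁅K⁆ LieAlgebra.SpecialLinear.sl (Fin 2) K))
    [AddCommGroup V] [Module K V] [LieRingModule 𝔤 V] [LieModule K 𝔤 V]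
    [FiniteDimensional K V] [LieModule.IsIrreducible K 𝔤 V]
    (δ : K) (hδ : δ ≠ 1) (D : 𝔤 →ₗ[K] V) (hD : D ∈ deltaDerivations K 𝔤 V δ) (hD0 : D ≠ 0) :
    δ = 1 / 2 ∧ Nonempty (𝔤 ≃ₗ⁅K,𝔤⁆ V) ∧
      ∀ e : 𝔤 ≃ₗ⁅K,𝔤⁆ V, ∃ c : K, ∀ x : 𝔤, D x = c • e x := by
  have hδ0 : δ ≠ 0 := by
    rintro rfl
    exact hD0 (eq_zero_of_mem_deltaDerivations_zero hD)
  have hinv (x y : 𝔤) : D ⁅x, y⁆ = ⁅x, D y⁆ := by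
    have := congr($(lie_eq_zero_of_mem_deltaDerivations hsl2 hδ hδ0 hD x) y)
    rw [LieHom.lie_apply, LinearMap.zero_apply, sub_eq_zero] at this
    exact this.symm
  let F : 𝔤 →ₗ⁅K,𝔤⁆ V := { D with map_lie' := hinv _ _ }
  have hF (x : 𝔤) : F x = D x := rfl
  have hker : F.ker = ⊥ := by
    refine (LieAlgebra.IsSimple.eq_bot_or_eq_top (R := K) _).resolve_right fun ht ↦ hD0 ?_
    ext x
    exact (ht ▸ LieSubmodule.mem_top x : x ∈ F.ker)
  have hrange : F.range = ⊤ := by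
    refine (IsSimpleOrder.eq_bot_or_eq_top _).resolve_left fun hb ↦ hD0 ?_
    ext x
    have : F x ∈ F.range := (LieModuleHom.mem_range F _).mpr ⟨x, rfl⟩
    rw [hb, LieSubmodule.mem_bot] at this
    exact this
  have hinj : Function.Injective D := (LieModuleHom.ker_eq_bot F).mp hker
  have hsurj : Function.Surjective D := (LieModuleHom.range_eq_top F).mp hrange
  refine ⟨?_, ⟨{ F, LinearEquiv.ofBijective D ⟨hinj, hsurj⟩ with }⟩, fun e ↦ ?_⟩
  · obtain ⟨x, y, hxy⟩ : ∃ x y : 𝔤, ⁅x, y⁆ ≠ 0 := by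
      by_contra! h
      exact LieAlgebra.IsSimple.non_abelian K (L := 𝔤) ⟨h⟩
    have h1 : D ⁅x, y⁆ = -(δ • ⁅y, D x⁆) + δ • ⁅x, D y⁆ := hD x y
    rw [← hinv, ← hinv, ← lie_skew x y, map_neg] at h1
    have h2 : (1 - 2 * δ) • D ⁅x, y⁆ = 0 := by
      rw [← lie_skew x y, map_neg]
      linear_combination (norm := module) h1
    have h3 := (smul_eq_zero.mp h2).resolve_right fun h ↦ hxy (hinj (by simpa using h))
    linear_combination (-1 / 2 : K) * h3
  · obtain ⟨c, hc⟩ := LieAlgebra.IsSimple.exists_eq_smul_of_comm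
      ((e.symm : V →ₗ⁅K,𝔤⁆ 𝔤).comp F)
    refine ⟨c, fun x ↦ ?_⟩
    have := congr(e $(hc x))
    simpa [hF] using this
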